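/- For a polynomial or power series $f(z)=\sum_k a_k z^k$ with nonzero complex coefficients, let $q_k(f)=\dfrac{a_{k-1}^2}{a_{k-2}a_k}$, $k\ge 2$, be its second quotients. For an integer $n\ge 1$ let $b_{2n}$ be the unique positive root of the equation $1-2\sum_{k=1}^{n}x^{-k^2/2}=0$, and let $b_\infty$ be the unique positive root of the equation $1-2\sum_{k=1}^{\infty}x^{-k^2/2}=0$. (i) Let $n\ge 1$ be an integer and let $P(z)=\sum_{k=0}^{2n}a_kz^k$ be a polynomial with $a_k\in\mathbb{C}\setminus\{0\}$ for all $0\le k\le 2n$. If $|q_k(P)|>b_{2n}$ for all $k=2,3,\dots,2n$, then all the zeros of $P$ are simple, and the moduli of the zeros of $P$ are pairwise different. (ii) Let $n\ge 1$ be an integer and let $P(z)=\sum_{k=0}^{2n+1}a_kz^k$ be a polynomial with $a_k\in\mathbb{C}\setminus\{0\}$ for all $0\le k\le 2n+1$. If $|q_k(P)|\ge b_{2n+2}$ for all $k=2,3,\dots,2n+1$, then all the zeros of $P$ are simple, and the moduli of the zeros of $P$ are pairwise different. (iii) Let $f(z)=\sum_{k=0}^{\infty}a_kz^k$ be an entire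 function with $a_k\in\mathbb{C}\setminus\{0\}$ for all $k\ge 0$. If $|q_k(f)|\ge b_\infty$ for all $k\ge 2$, then all the zeros of $f$ are simple, and the moduli of the zeros of $f$ are pairwise different. -/

import Mathlib

/-- The second quotient `q_k = a_{k-1}^2 / (a_{k-2} a_k)` of a coefficient sequence, for `k ≥ 2`. -/
noncomputable def secondQuotient (a : ℕ → ℂ) (k : ℕ) : ℂ :=
  a (k - 1) ^ 2 / (a (k - 2) * a k)

/-- `x` is a positive root of `1 - 2 ∑_{k=1}^n x^{-k^2/2} = 0`. -/
def IsEvenRoot (n : ℕ) (x : ℝ) : Prop :=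
  0 < x ∧ 1 - 2 * ∑ k ∈ Finset.Icc 1 n, x ^ (-(k : ℝ) ^ 2 / 2) = 0

/-- `x` is a positive root of `1 - 2 ∑_{k=1}^∞ x^{-k^2/2} = 0`, the series being convergent.
The summation index is shifted: the `k`-th summand below is the one for `k + 1`. -/
def IsInftyRoot (x : ℝ) : Prop :=
  0 < x ∧ Summable (fun k : ℕ => x ^ (-((k : ℝ) + 1) ^ 2 / 2)) ∧
    1 - 2 * ∑' k : ℕ, x ^ (-((k : ℝ) + 1) ^ 2 / 2) = 0

theorem rpow_four_half : (4 : ℝ) ^ (-(1 : ℝ) ^ 2 / 2) = 1 / 2 := by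
  rw [show (4 : ℝ) = 2 ^ (2 : ℝ) by norm_num, ← Real.rpow_mul (by norm_num)]
  norm_num [Real.rpow_neg]

theorem term_le_geometric (c x : ℝ) (hc : 1 < c) (hx : c ^ 2 ≤ x) (k : ℕ) :
    x ^ (-((k : ℝ) + 1) ^ 2 / 2) ≤ c⁻¹ * c⁻¹ ^ k := by
  have h0 : 0 < c := by linarith
  calc x ^ (-((k : ℝ) + 1) ^ 2 / 2)
      ≤ (c ^ 2) ^ (-((k : ℝ) + 1) ^ 2 / 2) :=
        Real.rpow_le_rpow_of_nonpos (by positivity) hx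
          (by have := sq_nonneg ((k : ℝ) + 1); linarith)
    _ = c ^ (-((k : ℝ) + 1) ^ 2) := by
        rw [← Real.rpow_natCast c 2, ← Real.rpow_mul h0.le]
        congr 1; push_cast; ring
    _ ≤ c ^ (-((k + 1 : ℕ) : ℝ)) := by
        apply Real.rpow_le_rpow_of_exponent_le hc.le
        have : (0 : ℝ) ≤ k := Nat.cast_nonneg k
        push_cast; nlinarith
    _ = c⁻¹ * c⁻¹ ^ k := by
        rw [Real.rpow_neg h0.le, Real.rpow_natCast, pow_succ, mul_inv, inv_pow, mul_comm]

theorem term_lt (x y : ℝ) (hx : 0 < x) (hxy : x < y) (k : ℕ) :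
    y ^ (-((k : ℝ) + 1) ^ 2 / 2) < x ^ (-((k : ℝ) + 1) ^ 2 / 2) :=
  Real.rpow_lt_rpow_of_neg hx hxy (by
    have : (0 : ℝ) < ((k : ℝ) + 1) ^ 2 := by positivity
    linarith)

theorem summable_geometric_bound (c : ℝ) (hc : 1 < c) :
    Summable (fun k : ℕ => c⁻¹ * c⁻¹ ^ k) :=
  (summable_geometric_of_lt_one (by positivity) (inv_lt_one_of_one_lt₀ hc)).mul_left _

theorem summable_terms (x : ℝ) (hx : 4 ≤ x) :
    Summable (fun k : ℕ => x ^ (-((k : ℝ) + 1) ^ 2 / 2)) :=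
  Summable.of_nonneg_of_le (fun k => Real.rpow_nonneg (by linarith) _)
    (fun k => term_le_geometric 2 x (by norm_num) (by linarith) k)
    (summable_geometric_bound 2 (by norm_num))

theorem tsum_nine_le : ∑' k : ℕ, (9 : ℝ) ^ (-((k : ℝ) + 1) ^ 2 / 2) ≤ 1 / 2 := by
  refine ((summable_terms 9 (by norm_num)).tsum_le_tsum
    (fun k => term_le_geometric 3 9 (by norm_num) (by norm_num) k)
    (summable_geometric_bound 3 (by norm_num))).trans ?_
  rw [tsum_mul_left, tsum_geometric_of_lt_one (by norm_num) (by norm_num)]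
  norm_num

theorem sum_Icc_shift (n : ℕ) (x : ℝ) :
    ∑ k ∈ Finset.Icc 1 n, x ^ (-(k : ℝ) ^ 2 / 2) =
      ∑ k ∈ Finset.range n, x ^ (-((k : ℝ) + 1) ^ 2 / 2) := by
  rw [Finset.range_eq_Ico, ← Finset.Ico_add_one_right_eq_Icc,
    ← Finset.sum_Ico_add' (fun k : ℕ => x ^ (-(k : ℝ) ^ 2 / 2)) 0 n 1]
  simp

theorem existsUnique_isEvenRoot (n : ℕ) (hn : 1 ≤ n) : ∃! x : ℝ, IsEvenRoot n x := by
  unfold IsEvenRoot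
  simp only [sum_Icc_shift]
  have hcont : ContinuousOn
      (fun x : ℝ => 1 - 2 * ∑ k ∈ Finset.range n, x ^ (-((k : ℝ) + 1) ^ 2 / 2))
      (Set.Icc 4 9) := by
    refine continuousOn_const.sub (continuousOn_const.mul (continuousOn_finsetSum _ ?_))
    intro k _
    exact continuousOn_id.rpow_const fun x hx => Or.inl (by
      have := hx.1; simp only [id]; linarith)
  have h4 : 1 / 2 ≤ ∑ k ∈ Finset.range n, (4 : ℝ) ^ (-((k : ℝ) + 1) ^ 2 / 2) := by
    have := Finset.single_le_sum
      (f := fun k : ℕ => (4 : ℝ) ^ (-((k : ℝ) + 1) ^ 2 / 2))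
      (fun k _ => Real.rpow_nonneg (by norm_num) _) (Finset.mem_range.2 hn)
    simpa [rpow_four_half] using rpow_four_half.symm.le.trans (by simpa using this)
  have h9 : ∑ k ∈ Finset.range n, (9 : ℝ) ^ (-((k : ℝ) + 1) ^ 2 / 2) ≤ 1 / 2 :=
    ((summable_terms 9 (by norm_num)).sum_le_tsum _
      (fun k _ => Real.rpow_nonneg (by norm_num) _)).trans tsum_nine_le
  obtain ⟨x, hx, hx0⟩ := intermediate_value_Icc (by norm_num) hcont
    (show (0 : ℝ) ∈ Set.Icc _ _ from ⟨by linarith, by linarith⟩)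
  have key : ∀ x y : ℝ, 0 < x → x < y →
      ∑ k ∈ Finset.range n, y ^ (-((k : ℝ) + 1) ^ 2 / 2) <
        ∑ k ∈ Finset.range n, x ^ (-((k : ℝ) + 1) ^ 2 / 2) := fun x y hx hxy =>
    Finset.sum_lt_sum_of_nonempty ⟨0, Finset.mem_range.2 hn⟩
      (fun k _ => term_lt x y hx hxy k)
  refine ⟨x, ⟨by have := hx.1; linarith, hx0⟩, ?_⟩
  rintro y ⟨hy, hy0⟩
  simp only at hx0
  rcases lt_trichotomy x y with h | h | h
  · have := key x y (by have := hx.1; linarith) h; linarith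
  · exact h.symm
  · have := key y x hy h; linarith

theorem existsUnique_isInftyRoot : ∃! x : ℝ, IsInftyRoot x := by
  have hcont : ContinuousOn
      (fun x : ℝ => 1 - 2 * ∑' k : ℕ, x ^ (-((k : ℝ) + 1) ^ 2 / 2)) (Set.Icc 4 9) := by
    refine continuousOn_const.sub (continuousOn_const.mul
      (continuousOn_tsum ?_ (summable_geometric_bound 2 (by norm_num)) ?_))
    · intro k
      exact continuousOn_id.rpow_const fun x hx => Or.inl (by
        have := hx.1; simp only [id]; linarith)
    · intro k x hx
      rw [Real.norm_of_nonneg (Real.rpow_nonneg (by have := hx.1; linarith) _)]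
      exact term_le_geometric 2 x (by norm_num) (by have := hx.1; linarith) k
  have h4 : 1 / 2 ≤ ∑' k : ℕ, (4 : ℝ) ^ (-((k : ℝ) + 1) ^ 2 / 2) := by
    have := (summable_terms 4 le_rfl).le_tsum 0
      (fun k _ => Real.rpow_nonneg (by norm_num) _)
    exact rpow_four_half.symm.le.trans (by simpa using this)
  have h9 := tsum_nine_le
  obtain ⟨x, hx, hx0⟩ := intermediate_value_Icc (by norm_num) hcont
    (show (0 : ℝ) ∈ Set.Icc _ _ from ⟨by linarith, by linarith⟩)
  simp only at hx0
  have key : ∀ x y : ℝ, IsInftyRoot x → IsInftyRoot y → ¬ x < y := by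
    rintro x y ⟨hx, hxs, hx0⟩ ⟨-, hys, hy0⟩ hxy
    have := hys.tsum_lt_tsum (fun k => (term_lt x y hx hxy k).le) (term_lt x y hx hxy 0) hxs
    linarith
  have hroot : IsInftyRoot x :=
    ⟨by have := hx.1; linarith, summable_terms x hx.1, hx0⟩
  exact ⟨x, hroot, fun y hy => le_antisymm (not_lt.1 (key x y hroot hy))
    (not_lt.1 (key y x hy hroot))⟩

/-- The constant `b_{2n}`, `n ≥ 1`: the unique positive root of
`1 - 2 ∑_{k=1}^n x^{-k^2/2} = 0`. -/
noncomputable def bEven (n : ℕ) (hn : 1 ≤ n) : ℝ :=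
  Classical.choose (existsUnique_isEvenRoot n hn).exists

/-- The constant `b_∞`: the unique positive root of `1 - 2 ∑_{k=1}^∞ x^{-k^2/2} = 0`. -/
noncomputable def bInfty : ℝ :=
  Classical.choose existsUnique_isInftyRoot.exists

theorem bEven_spec (n : ℕ) (hn : 1 ≤ n) : IsEvenRoot n (bEven n hn) :=
  Classical.choose_spec (existsUnique_isEvenRoot n hn).exists

theorem bInfty_spec : IsInftyRoot bInfty :=
  Classical.choose_spec existsUnique_isInftyRoot.exists

/-! Put s = c^(-1/2), where c bounds all |q_k| from below. Then |a_k a_{k+2}| ≤ s² |a_{k+1}|², so on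
any circle the ratios of consecutive term moduli shrink by a factor s² at each step. On a circle
where both neighbours of the term of index j are at most s times that term, the term at distance m
is at most s^(m²) times it. All other terms together are then at most θ_j + θ_{N-j} times the
central one, where θ_n = ∑_{m=1}^n s^(m²) (`norm_sum_sub_le`).

The equations defining `bEven` and `bInfty` say 2θ = 1, and concavity of n ↦ θ_n makes the balanced
split the worst, so the factor is below 1. The term of index j thus dominates on a circle of radius
ρ_j, and the disc inside holds exactly j zeros (`zeroCount_of_dominant`). Between consecutive
circles there is room for only one zero, counted with multiplicity (`not_two_zeros_of_dominant`),
which excludes both multiple zeros and distinct zeros of equal modulus. -/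

/-! ### Counting zeros by the logarithmic derivative -/

/-- The number of zeros of `f` in the disc of radius `r` around `0`, as the normalized integral
of the logarithmic derivative over the boundary circle. -/
noncomputable def zeroCount (f : ℂ → ℂ) (r : ℝ) : ℂ :=
  (2 * Real.pi * Complex.I)⁻¹ * ∮ z in C(0, r), logDeriv f z

theorem differentiable_logDeriv_at {f : ℂ → ℂ} (hf : Differentiable ℂ f) {z : ℂ}
    (hz : f z ≠ 0) : DifferentiableAt ℂ (logDeriv f) z :=
  (hf.deriv z).div (hf z) hz

theorem circleIntegrable_logDeriv {f : ℂ → ℂ} (hf : Differentiable ℂ f) {r : ℝ} (hr : 0 ≤ r)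
    (h0 : ∀ z, ‖z‖ = r → f z ≠ 0) : CircleIntegrable (logDeriv f) 0 r :=
  ContinuousOn.circleIntegrable hr fun z hz =>
    (differentiable_logDeriv_at hf (h0 z (by simpa using hz))).continuousAt.continuousWithinAt

theorem zeroCount_mul {f g : ℂ → ℂ} (hf : Differentiable ℂ f) (hg : Differentiable ℂ g) {r : ℝ}
    (hr : 0 ≤ r) (hf0 : ∀ z, ‖z‖ = r → f z ≠ 0) (hg0 : ∀ z, ‖z‖ = r → g z ≠ 0) :
    zeroCount (fun z => f z * g z) r = zeroCount f r + zeroCount g r := by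
  unfold zeroCount
  rw [← mul_add, ← circleIntegral.integral_add (circleIntegrable_logDeriv hf hr hf0)
    (circleIntegrable_logDeriv hg hr hg0)]
  congr 1
  refine circleIntegral.integral_congr hr fun z hz => ?_
  have hz : ‖z‖ = r := by simpa using hz
  exact logDeriv_mul z (hf0 z hz) (hg0 z hz) (hf z) (hg z)

theorem logDeriv_sub_const_id (w z : ℂ) : logDeriv (fun x => x - w) z = (z - w)⁻¹ := by
  simp [logDeriv_apply]

theorem zeroCount_sub_of_lt {w : ℂ} {r : ℝ} (hw : ‖w‖ < r) :
    zeroCount (fun z => z - w) r = 1 := by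
  unfold zeroCount
  simp only [logDeriv_sub_const_id]
  rw [circleIntegral.integral_sub_inv_of_mem_ball (by simpa using hw)]
  exact inv_mul_cancel₀ Complex.two_pi_I_ne_zero

theorem zeroCount_eq_zero {f : ℂ → ℂ} (hf : Differentiable ℂ f) {r : ℝ} (hr : 0 ≤ r)
    (h0 : ∀ z, ‖z‖ ≤ r → f z ≠ 0) : zeroCount f r = 0 := by
  unfold zeroCount
  rw [Complex.circleIntegral_eq_zero_of_differentiable_on_off_countable hr Set.countable_empty,
    mul_zero]
  · exact fun z hz => (differentiable_logDeriv_at hf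
      (h0 z (by simpa using hz))).continuousAt.continuousWithinAt
  · exact fun z hz => differentiable_logDeriv_at hf (h0 z (by simpa using Metric.ball_subset_closedBall hz.1))

theorem zeroCount_sub_of_gt {w : ℂ} {r : ℝ} (hr : 0 ≤ r) (hw : r < ‖w‖) :
    zeroCount (fun z => z - w) r = 0 :=
  zeroCount_eq_zero (by fun_prop) hr fun z hz h => by
    rw [sub_eq_zero.1 h] at hz; linarith

theorem zeroCount_eq_of_annulus {f : ℂ → ℂ} (hf : Differentiable ℂ f) {r R : ℝ} (hr : 0 < r)
    (hrR : r ≤ R) (h0 : ∀ z, r ≤ ‖z‖ → ‖z‖ ≤ R → f z ≠ 0) : zeroCount f R = zeroCount f r := by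
  unfold zeroCount
  rw [Complex.circleIntegral_eq_of_differentiable_on_annulus_off_countable hr hrR
    Set.countable_empty]
  · intro z hz
    exact (differentiable_logDeriv_at hf (h0 z (by simpa using hz.2)
      (by simpa using hz.1))).continuousAt.continuousWithinAt
  · intro z hz
    have h1 := hz.1.1
    have h2 := hz.1.2
    simp only [Metric.mem_ball, Metric.mem_closedBall, dist_zero_right, not_le] at h1 h2
    exact differentiable_logDeriv_at hf (h0 z h2.le h1.le)

/-- If the monomial `α z ^ j` dominates on the circle of radius `r`, then there are `j` zeros
inside. -/
theorem zeroCount_of_dominant {f : ℂ → ℂ} (hf : Differentiable ℂ f) {r : ℝ} (hr : 0 < r)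
    {α : ℂ} {j : ℕ} (hdom : ∀ z, ‖z‖ = r → ‖f z - α * z ^ j‖ < ‖α * z ^ j‖) :
    zeroCount f r = j := by
  have hα : α ≠ 0 := by
    rintro rfl
    have := hdom r (by simp [abs_of_pos hr])
    simp at this
    linarith [norm_nonneg (f r)]
  have hz0 : ∀ z : ℂ, ‖z‖ = r → z ≠ 0 := fun z hz h => by
    rw [h, norm_zero] at hz; exact hr.ne hz
  have hm : ∀ z : ℂ, ‖z‖ = r → α * z ^ j ≠ 0 := fun z hz =>
    mul_ne_zero hα (pow_ne_zero _ (hz0 z hz))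
  have hslit : ∀ z : ℂ, ‖z‖ = r → f z / (α * z ^ j) ∈ Complex.slitPlane := by
    intro z hz
    rw [← add_sub_cancel 1 (f z / (α * z ^ j))]
    apply Complex.mem_slitPlane_of_norm_lt_one
    rw [div_sub_one (hm z hz), norm_div, div_lt_one (norm_pos_iff.2 (hm z hz))]
    exact hdom z hz
  have hfz : ∀ z : ℂ, ‖z‖ = r → f z ≠ 0 := by
    intro z hz h
    have := hdom z hz
    simp [h] at this
  have hint : (∮ z in C(0, r), (logDeriv f z - j * (z - 0)⁻¹)) = 0 := by
    refine circleIntegral.integral_eq_zero_of_hasDerivWithinAt hr.le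
      -- The quotient stays within distance 1 of 1, so its principal logarithm is a primitive of
      -- f'/f - j/z along the whole circle.
      (f := fun z => Complex.log (f z / (α * z ^ j))) fun z hz => ?_
    have hz : ‖z‖ = r := by simpa using hz
    have hd : HasDerivAt (fun z : ℂ => α * z ^ j) (α * (j * z ^ (j - 1))) z :=
      (hasDerivAt_pow j z).const_mul α
    have h1 := ((hf z).hasDerivAt.fun_div hd (hm z hz)).clog (hslit z hz)
    refine (h1.congr_deriv ?_).hasDerivWithinAt
    have h3 : z ≠ 0 := hz0 z hz
    have h4 := hfz z hz
    rw [logDeriv_apply, sub_zero]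
    -- The exponent `j - 1` is truncated at `j = 0`, where the derivative of the monomial vanishes.
    cases j with
    | zero => simp; field_simp
    | succ j =>
      simp only [Nat.add_sub_cancel]
      field_simp
      push_cast
      ring
  have hci : CircleIntegrable (fun z : ℂ => (j : ℂ) * (z - 0)⁻¹) 0 r := by
    refine ContinuousOn.circleIntegrable hr.le fun z hz => ?_
    have : z - 0 ≠ 0 := by simpa using hz0 z (by simpa using hz)
    exact (continuousAt_const.mul
      ((continuousAt_id.sub continuousAt_const).inv₀ this)).continuousWithinAt
  rw [circleIntegral.integral_sub (circleIntegrable_logDeriv hf hr.le hfz) hci,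
    circleIntegral.integral_const_mul,
    circleIntegral.integral_sub_inv_of_mem_ball (by simpa using hr),
    sub_eq_zero] at hint
  unfold zeroCount
  rw [hint]
  field_simp [Complex.two_pi_I_ne_zero]

/-! ### Dividing out zeros -/

theorem eq_sub_mul_dslope {f : ℂ → ℂ} {w : ℂ} (hw : f w = 0) :
    f = fun z => (z - w) * dslope f w z := by
  ext z
  have := sub_smul_dslope f w z
  rw [hw, sub_zero, smul_eq_mul] at this
  exact this.symm

theorem Differentiable.dslope_complex {f : ℂ → ℂ} (hf : Differentiable ℂ f) (w : ℂ) :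
    Differentiable ℂ (dslope f w) := by
  rw [← differentiableOn_univ] at hf ⊢
  exact (Complex.differentiableOn_dslope Filter.univ_mem).2 hf

/-- Removing a zero between the two radii lowers the increment of the zero count by one. -/
theorem zeroCount_sub_of_factor {g : ℂ → ℂ} (hg : Differentiable ℂ g) {r R : ℝ} (hr : 0 ≤ r)
    (hR : 0 ≤ R) {w : ℂ} (hrw : r < ‖w‖) (hwR : ‖w‖ < R) (hg1 : ∀ z, ‖z‖ = r → g z ≠ 0)
    (hg2 : ∀ z, ‖z‖ = R → g z ≠ 0) :
    zeroCount (fun z => (z - w) * g z) R - zeroCount (fun z => (z - w) * g z) r =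
      1 + (zeroCount g R - zeroCount g r) := by
  have hd : Differentiable ℂ (fun z : ℂ => z - w) := by fun_prop
  rw [zeroCount_mul hd hg hR (fun z hz h => by rw [sub_eq_zero.1 h] at hz; linarith) hg2,
    zeroCount_mul hd hg hr (fun z hz h => by rw [sub_eq_zero.1 h] at hz; linarith) hg1,
    zeroCount_sub_of_lt hwR, zeroCount_sub_of_gt hr hrw]
  ring

/-- A Jensen-type bound makes the removal of zeros terminate. Dividing by z - w with |w| < R lowers
the bound on the circle of radius 3R by a factor at least 2R, but lowers |f(0)| by a factor less
than R. Each division therefore halves the admissible ratio of M to |f(0)|, and each adds 1 to the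
increment. Once the annulus is free of zeros, the increment is 0. -/
theorem zeroCount_increment_nonneg_of_bound {r R : ℝ} (hr : 0 < r) (hrR : r ≤ R) (m : ℕ) :
    ∀ (f : ℂ → ℂ) (M : ℝ), Differentiable ℂ f → (∀ z, ‖z‖ = r → f z ≠ 0) →
      (∀ z, ‖z‖ = R → f z ≠ 0) → (∀ z, ‖z‖ = 3 * R → ‖f z‖ ≤ M) → M < 2 ^ m * ‖f 0‖ →
      0 ≤ (zeroCount f R - zeroCount f r).re := by
  have hR : 0 < R := hr.trans_le hrR
  induction m with
  | zero =>
    -- With M < |f(0)| the maximum principle is violated, so this case is void.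
    intro f M hf _ _ hM hlt
    have := Complex.norm_le_of_forall_mem_frontier_norm_le (U := Metric.ball (0 : ℂ) (3 * R))
      Metric.isBounded_ball hf.diffContOnCl (C := M)
      (fun z hz => hM z (by
        rw [frontier_ball _ (by positivity)] at hz; simpa using hz))
      (z := 0) (subset_closure (by simpa using hR))
    simp at hlt
    linarith
  | succ m ih =>
    intro f M hf h1 h2 hM hlt
    by_cases hz : ∀ z, r ≤ ‖z‖ → ‖z‖ ≤ R → f z ≠ 0
    · rw [zeroCount_eq_of_annulus hf hr hrR hz]; simp
    push Not at hz
    obtain ⟨w, hrw, hwR, hw⟩ := hz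
    have hrw : r < ‖w‖ := lt_of_le_of_ne hrw fun h => h1 w h.symm hw
    have hwR : ‖w‖ < R := lt_of_le_of_ne hwR fun h => h2 w h hw
    have hfac := eq_sub_mul_dslope hw
    have hval : ∀ z, f z = (z - w) * dslope f w z := fun z => congrFun hfac z
    have hgd := hf.dslope_complex w
    set g := dslope f w
    have hg1 : ∀ z, ‖z‖ = r → g z ≠ 0 := fun z hz h => h1 z hz (by rw [hval, h, mul_zero])
    have hg2 : ∀ z, ‖z‖ = R → g z ≠ 0 := fun z hz h => h2 z hz (by rw [hval, h, mul_zero])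
    rw [hfac, zeroCount_sub_of_factor hgd hr.le hR.le hrw hwR hg1 hg2]
    have := ih g (M / (2 * R)) hgd hg1 hg2 ?_ ?_
    · rw [Complex.add_re, Complex.one_re]; linarith
    · intro z hz
      rw [le_div_iff₀ (by positivity)]
      have h3 : 2 * R ≤ ‖z - w‖ := by
        have := norm_sub_norm_le z w; linarith
      have h4 := hM z hz
      rw [hval, norm_mul] at h4
      nlinarith [norm_nonneg (g z)]
    · rw [div_lt_iff₀ (by positivity)]
      have h5 : ‖f 0‖ ≤ R * ‖g 0‖ := by
        rw [hval, norm_mul, zero_sub, norm_neg]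
        exact mul_le_mul_of_nonneg_right hwR.le (norm_nonneg _)
      have h6 := mul_le_mul_of_nonneg_left h5 (show (0 : ℝ) ≤ 2 ^ (m + 1) by positivity)
      rw [pow_succ] at h6 hlt
      nlinarith

theorem zeroCount_increment_nonneg {f : ℂ → ℂ} (hf : Differentiable ℂ f) (hf0 : f 0 ≠ 0)
    {r R : ℝ} (hr : 0 < r) (hrR : r ≤ R) (h1 : ∀ z, ‖z‖ = r → f z ≠ 0)
    (h2 : ∀ z, ‖z‖ = R → f z ≠ 0) : 0 ≤ (zeroCount f R - zeroCount f r).re := by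
  obtain ⟨M, hM⟩ := (isCompact_sphere (0 : ℂ) (3 * R)).exists_bound_of_continuousOn
    hf.continuous.continuousOn
  obtain ⟨m, hm⟩ := pow_unbounded_of_one_lt (M / ‖f 0‖) (one_lt_two (α := ℝ))
  exact zeroCount_increment_nonneg_of_bound hr hrR m f M hf h1 h2
    (fun z hz => hM z (by simpa using hz)) ((div_lt_iff₀ (norm_pos_iff.2 hf0)).1 hm)

/-- If consecutive monomials dominate on two circles, then the annulus between them does not
contain two zeros, counted with multiplicity. -/
theorem not_two_zeros_of_dominant {f : ℂ → ℂ} (hf : Differentiable ℂ f) (hf0 : f 0 ≠ 0)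
    {r R : ℝ} (hr : 0 < r) {α β : ℂ} {j : ℕ}
    (hα : ∀ z, ‖z‖ = r → ‖f z - α * z ^ j‖ < ‖α * z ^ j‖)
    (hβ : ∀ z, ‖z‖ = R → ‖f z - β * z ^ (j + 1)‖ < ‖β * z ^ (j + 1)‖)
    {z w : ℂ} (hz : f z = 0) (hw : dslope f z w = 0) (hrz : r ≤ ‖z‖) (hzR : ‖z‖ < R)
    (hzw : ‖w‖ = ‖z‖) : False := by
  have hR : 0 < R := by linarith
  have h1 : ∀ x, ‖x‖ = r → f x ≠ 0 := fun x hx h => by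
    have := hα x hx; simp [h] at this
  have h2 : ∀ x, ‖x‖ = R → f x ≠ 0 := fun x hx h => by
    have := hβ x hx; simp [h] at this
  have hrz : r < ‖z‖ := lt_of_le_of_ne hrz fun h => h1 z h.symm hz
  have hN := zeroCount_of_dominant hf hr hα
  have hM := zeroCount_of_dominant hf hR hβ
  have hfac := eq_sub_mul_dslope hz
  have hgd := hf.dslope_complex z
  set g := dslope f z
  have hgfac := eq_sub_mul_dslope hw
  have hhd := hgd.dslope_complex w
  set h := dslope g w
  have hfv : ∀ x, f x = (x - z) * g x := fun x => congrFun hfac x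
  have hgv : ∀ x, g x = (x - w) * h x := fun x => congrFun hgfac x
  have hg1 : ∀ x, ‖x‖ = r → g x ≠ 0 := fun x hx e => h1 x hx (by rw [hfv, e, mul_zero])
  have hg2 : ∀ x, ‖x‖ = R → g x ≠ 0 := fun x hx e => h2 x hx (by rw [hfv, e, mul_zero])
  have hh1 : ∀ x, ‖x‖ = r → h x ≠ 0 := fun x hx e => hg1 x hx (by rw [hgv, e, mul_zero])
  have hh2 : ∀ x, ‖x‖ = R → h x ≠ 0 := fun x hx e => hg2 x hx (by rw [hgv, e, mul_zero])
  have e1 := zeroCount_sub_of_factor hgd hr.le hR.le hrz hzR hg1 hg2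
  have e2 := zeroCount_sub_of_factor hhd hr.le hR.le (w := w) (by linarith) (by linarith) hh1 hh2
  rw [← hfac, hN, hM] at e1
  rw [← hgfac] at e2
  have hh0 : h 0 ≠ 0 := fun e => hf0 (by rw [hfv, hgv, e]; simp)
  -- The increment of f is (j + 1) - j = 1, yet the two factors contribute 2 and the remaining
  -- quotient contributes a nonnegative amount.
  have := zeroCount_increment_nonneg hhd hh0 hr (by linarith) hh1 hh2
  rw [e2] at e1
  have e3 := congrArg Complex.re e1
  simp at e3 this
  linarith

/-! ### Decay of the terms and partial theta sums -/

/-- The first ratio is at most s and each later one at most s² times its predecessor, so the ratios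
are bounded by s, s³, s⁵, …; the sum of the first m odd numbers is m². -/
theorem le_pow_sq_mul {u : ℕ → ℝ} {M : ℕ} {s : ℝ} (hs : 0 < s) (hu : ∀ m ≤ M, 0 < u m)
    (h1 : 1 ≤ M → u 1 ≤ s * u 0)
    (hc : ∀ m, m + 2 ≤ M → u m * u (m + 2) ≤ s ^ 2 * u (m + 1) ^ 2) :
    ∀ m ≤ M, u m ≤ s ^ (m ^ 2) * u 0 := by
  have hstep : ∀ m, m + 1 ≤ M → u (m + 1) ≤ s ^ (2 * m + 1) * u m := by
    intro m
    induction m with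
    | zero => simpa using h1
    | succ m ih =>
      intro hm
      have h2 := hc m hm
      have h3 := ih (by omega)
      have h4 := hu m (by omega)
      have h5 := hu (m + 1) (by omega)
      refine le_of_mul_le_mul_left ?_ h4
      calc u m * u (m + 2) ≤ s ^ 2 * u (m + 1) ^ 2 := h2
        _ = s ^ 2 * u (m + 1) * u (m + 1) := by ring
        _ ≤ s ^ 2 * u (m + 1) * (s ^ (2 * m + 1) * u m) := by gcongr
        _ = u m * (s ^ (2 * (m + 1) + 1) * u (m + 1)) := by ring
  intro m
  induction m with
  | zero => simp
  | succ m ih =>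
    intro hm
    calc u (m + 1) ≤ s ^ (2 * m + 1) * u m := hstep m hm
      _ ≤ s ^ (2 * m + 1) * (s ^ (m ^ 2) * u 0) := by gcongr; exact ih (by omega)
      _ = s ^ ((m + 1) ^ 2) * u 0 := by rw [← mul_assoc, ← pow_add]; congr 2; ring

/-- The partial theta sum `∑_{m=1}^n s ^ (m ^ 2)`. -/
noncomputable def thetaSum (s : ℝ) (n : ℕ) : ℝ :=
  ∑ m ∈ Finset.range n, s ^ ((m + 1) ^ 2)

theorem thetaSum_succ (s : ℝ) (n : ℕ) :
    thetaSum s (n + 1) = thetaSum s n + s ^ ((n + 1) ^ 2) :=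
  Finset.sum_range_succ _ _

theorem thetaSum_lt_succ {s : ℝ} (hs : 0 < s) (n : ℕ) : thetaSum s n < thetaSum s (n + 1) := by
  rw [thetaSum_succ]
  have : 0 < s ^ ((n + 1) ^ 2) := by positivity
  linarith

theorem thetaSum_mono {s : ℝ} (hs : 0 < s) : Monotone (thetaSum s) :=
  monotone_nat_of_le_succ fun n => (thetaSum_lt_succ hs n).le

theorem le_thetaSum {s : ℝ} (hs : 0 < s) {n : ℕ} (hn : 1 ≤ n) : s ≤ thetaSum s n := by
  have h1 : thetaSum s 1 = s := by simp [thetaSum]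
  exact h1.symm.le.trans (thetaSum_mono hs hn)

/-- Concavity: the increments s^(m²) decrease in m, so moving both indices one step towards the
middle gains at least as much as it loses. -/
theorem thetaSum_add_le {s : ℝ} (hs : 0 < s) (hs1 : s ≤ 1) (k d : ℕ) :
    thetaSum s k + thetaSum s (k + 2 * d) ≤ 2 * thetaSum s (k + d) := by
  induction d generalizing k with
  | zero => simp [two_mul]
  | succ d ih =>
    have h := ih (k + 1)
    rw [show k + 1 + 2 * d = k + 2 * d + 1 by ring, show k + 1 + d = k + (d + 1) by ring,
      thetaSum_succ s k] at h
    have h2 : s ^ ((k + 2 * d + 1 + 1) ^ 2) ≤ s ^ ((k + 1) ^ 2) :=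
      pow_le_pow_of_le_one hs.le hs1 (Nat.pow_le_pow_left (by omega) 2)
    rw [show k + 2 * (d + 1) = k + 2 * d + 1 + 1 by ring, thetaSum_succ s (k + 2 * d + 1)]
    linarith

theorem thetaSum_add_thetaSum_le {s : ℝ} (hs : 0 < s) (hs1 : s ≤ 1) {n i j : ℕ}
    (h : i + j = 2 * n) : thetaSum s i + thetaSum s j ≤ 2 * thetaSum s n := by
  rcases le_total i j with hij | hij
  · have := thetaSum_add_le hs hs1 i (n - i)
    rwa [show i + 2 * (n - i) = j by omega, show i + (n - i) = n by omega] at this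
  · have := thetaSum_add_le hs hs1 j (n - j)
    rw [show j + 2 * (n - j) = i by omega, show j + (n - j) = n by omega] at this
    linarith

/-- On suitable circles all terms of a polynomial with strongly log-concave coefficients are
controlled by the term of index `j`. -/
theorem norm_sum_sub_le {a : ℕ → ℂ} {N j : ℕ} {s : ℝ} (hs : 0 < s) (hj : j ≤ N)
    (ha : ∀ k ≤ N, a k ≠ 0)
    (hq : ∀ k, k + 2 ≤ N → ‖a k‖ * ‖a (k + 2)‖ ≤ s ^ 2 * ‖a (k + 1)‖ ^ 2)
    {z : ℂ} (hz : z ≠ 0) (hR : j + 1 ≤ N → ‖a (j + 1)‖ * ‖z‖ ≤ s * ‖a j‖)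
    (hL : ∀ i, i + 1 = j → ‖a i‖ ≤ s * ‖a j‖ * ‖z‖) :
    ‖∑ k ∈ Finset.range (N + 1), a k * z ^ k - a j * z ^ j‖ ≤
      (thetaSum s j + thetaSum s (N - j)) * ‖a j * z ^ j‖ := by
  obtain ⟨d, rfl⟩ := Nat.exists_eq_add_of_le hj
  have hz' : 0 < ‖z‖ := norm_pos_iff.2 hz
  have ht : ∀ k ≤ j + d, 0 < ‖a k * z ^ k‖ := fun k hk =>
    norm_pos_iff.2 (mul_ne_zero (ha k hk) (pow_ne_zero _ hz))
  have htq : ∀ k, k + 2 ≤ j + d →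
      ‖a k * z ^ k‖ * ‖a (k + 2) * z ^ (k + 2)‖ ≤ s ^ 2 * ‖a (k + 1) * z ^ (k + 1)‖ ^ 2 := by
    intro k hk
    simp only [norm_mul, norm_pow]
    calc ‖a k‖ * ‖z‖ ^ k * (‖a (k + 2)‖ * ‖z‖ ^ (k + 2))
        = ‖a k‖ * ‖a (k + 2)‖ * ‖z‖ ^ (2 * (k + 1)) := by ring
      _ ≤ s ^ 2 * ‖a (k + 1)‖ ^ 2 * ‖z‖ ^ (2 * (k + 1)) :=
          mul_le_mul_of_nonneg_right (hq k hk) (by positivity)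
      _ = _ := by ring
  have hright := le_pow_sq_mul (u := fun m => ‖a (j + m) * z ^ (j + m)‖) (M := d) hs
    (fun m hm => ht _ (by omega))
    (fun h1 => by
      simp only [norm_mul, norm_pow, add_zero]
      calc ‖a (j + 1)‖ * ‖z‖ ^ (j + 1) = ‖a (j + 1)‖ * ‖z‖ * ‖z‖ ^ j := by ring
        _ ≤ s * ‖a j‖ * ‖z‖ ^ j :=
            mul_le_mul_of_nonneg_right (hR (by omega)) (by positivity)
        _ = _ := by ring)
    (fun m hm => htq (j + m) (by omega))
  have hleft := le_pow_sq_mul (u := fun m => ‖a (j - m) * z ^ (j - m)‖) (M := j) hs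
    (fun m hm => ht _ (by omega))
    (fun h1 => by
      obtain ⟨i, rfl⟩ := Nat.exists_eq_add_of_le' h1
      simp only [norm_mul, norm_pow, Nat.add_sub_cancel, Nat.sub_zero]
      calc ‖a i‖ * ‖z‖ ^ i ≤ s * ‖a (i + 1)‖ * ‖z‖ * ‖z‖ ^ i := by gcongr; exact hL i rfl
        _ = _ := by ring)
    (fun m hm => by
      have := htq (j - (m + 2)) (by omega)
      rw [show j - (m + 2) + 2 = j - m by omega, show j - (m + 2) + 1 = j - (m + 1) by omega]
        at this
      rwa [mul_comm])
  simp only [add_zero, Nat.sub_zero] at hright hleft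
  rw [add_assoc, Finset.sum_range_add, Finset.sum_range_succ', add_zero, ← add_assoc,
    add_sub_cancel_right, Nat.add_sub_cancel_left, add_mul]
  refine (norm_add_le _ _).trans (add_le_add ?_ ?_)
  · rw [← Finset.sum_range_reflect, thetaSum, Finset.sum_mul]
    refine norm_sum_le_of_le _ fun m hm => ?_
    rw [Finset.mem_range] at hm
    rw [show j - 1 - m = j - (m + 1) by omega]
    exact hleft (m + 1) (by omega)
  · rw [thetaSum, Finset.sum_mul]
    refine norm_sum_le_of_le _ fun m hm => ?_
    rw [Finset.mem_range] at hm
    exact hright (m + 1) (by omega)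

/-! ### Circles of dominance -/

/-- Radii of circles on which the term of index `j` dominates. -/
noncomputable def dominantRadius (a : ℕ → ℂ) (s : ℝ) : ℕ → ℝ
  | 0 => s * ‖a 0‖ / ‖a 1‖
  | j + 1 => ‖a j‖ / (s * ‖a (j + 1)‖)

theorem dominantRadius_pos {a : ℕ → ℂ} {s : ℝ} (hs : 0 < s) {N : ℕ} (hN : 1 ≤ N)
    (ha : ∀ k ≤ N, a k ≠ 0) {j : ℕ} (hj : j ≤ N) : 0 < dominantRadius a s j := by
  have hp : ∀ k ≤ N, 0 < ‖a k‖ := fun k hk => norm_pos_iff.2 (ha k hk)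
  cases j with
  | zero => exact div_pos (mul_pos hs (hp 0 (by omega))) (hp 1 hN)
  | succ j => exact div_pos (hp j (by omega)) (mul_pos hs (hp (j + 1) hj))

theorem le_of_dominantRadius_le {a : ℕ → ℂ} {s : ℝ} (hs : 0 < s) {j : ℕ} (ha : a (j + 1) ≠ 0)
    {r : ℝ} (hr : dominantRadius a s (j + 1) ≤ r) : ‖a j‖ ≤ s * ‖a (j + 1)‖ * r := by
  have := (div_le_iff₀ (mul_pos hs (norm_pos_iff.2 ha))).1 hr
  linarith

/-- For positive index the radius makes the left neighbour exactly s times the central term;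
log-concavity with factor s² then keeps the right neighbour within s. Index 0 has no left neighbour,
and its radius is fixed by the right one. -/
theorem mul_le_of_le_dominantRadius {a : ℕ → ℂ} {s : ℝ} (hs : 0 < s) {N : ℕ}
    (ha : ∀ k ≤ N, a k ≠ 0)
    (hq : ∀ k, k + 2 ≤ N → ‖a k‖ * ‖a (k + 2)‖ ≤ s ^ 2 * ‖a (k + 1)‖ ^ 2) {j : ℕ}
    (hj : j + 1 ≤ N) {r : ℝ} (hr : r ≤ dominantRadius a s j) :
    ‖a (j + 1)‖ * r ≤ s * ‖a j‖ := by
  cases j with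
  | zero =>
    have := (le_div_iff₀ (norm_pos_iff.2 (ha 1 hj))).1 hr
    linarith
  | succ j =>
    have h1 : 0 < ‖a (j + 1)‖ := norm_pos_iff.2 (ha _ (by omega))
    have h2 := (le_div_iff₀ (mul_pos hs h1)).1 hr
    have h3 := hq j hj
    refine le_of_mul_le_mul_left ?_ (mul_pos hs h1)
    calc s * ‖a (j + 1)‖ * (‖a (j + 1 + 1)‖ * r)
        = r * (s * ‖a (j + 1)‖) * ‖a (j + 2)‖ := by ring
      _ ≤ ‖a j‖ * ‖a (j + 2)‖ := by gcongr
      _ ≤ s ^ 2 * ‖a (j + 1)‖ ^ 2 := h3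
      _ = _ := by ring

/-- If the terms of index `0, …, j` dominate on circles of suitable radii, then zeros in the disc
bounded by the last circle are simple and have distinct moduli. -/
theorem dslope_ne_zero_of_dominant {f : ℂ → ℂ} (hf : Differentiable ℂ f) (hf0 : f 0 ≠ 0)
    {a : ℕ → ℂ} {ρ : ℕ → ℝ} {j : ℕ} (hρ : ∀ i ≤ j, 0 < ρ i)
    (h0 : ∀ z, z ≠ 0 → ‖z‖ ≤ ρ 0 → ‖f z - a 0 * z ^ 0‖ < ‖a 0 * z ^ 0‖)
    (hdom : ∀ i ≤ j, ∀ z, ‖z‖ = ρ i → ‖f z - a i * z ^ i‖ < ‖a i * z ^ i‖)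
    {z w : ℂ} (hz : f z = 0) (hzj : ‖z‖ < ρ j) (hzw : ‖w‖ = ‖z‖) : dslope f z w ≠ 0 := by
  intro hw
  -- Taking the first circle that encloses z gives the annulus containing z without any monotonicity
  -- of the radii.
  have hex : ∃ i, ‖z‖ < ρ i := ⟨j, hzj⟩
  classical
  have hlt := Nat.find_spec hex
  have hle : Nat.find hex ≤ j := Nat.find_min' hex hzj
  have hmin : ∀ i < Nat.find hex, ρ i ≤ ‖z‖ := fun i hi => not_lt.1 (Nat.find_min hex hi)
  generalize Nat.find hex = i at hlt hle hmin
  cases i with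
  | zero =>
    have := h0 z (fun h => hf0 (h ▸ hz)) hlt.le
    simp [hz] at this
  | succ i =>
    exact not_two_zeros_of_dominant hf hf0 (hρ i (by omega)) (hdom i (by omega))
      (hdom (i + 1) hle) hz hw (hmin i (by omega)) hlt hzw

/-- The divided slope is the derivative at w = z and the ordinary slope at w ≠ z, so one condition
covers both multiple zeros and zeros of equal modulus. -/
theorem simple_and_norm_ne_of_dslope_ne_zero {f : ℂ → ℂ}
    (h : ∀ z w, f z = 0 → ‖w‖ = ‖z‖ → dslope f z w ≠ 0) :
    (∀ z, f z = 0 → deriv f z ≠ 0) ∧ ∀ z w, f z = 0 → f w = 0 → z ≠ w → ‖z‖ ≠ ‖w‖ := by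
  refine ⟨fun z hz => ?_, fun z w hz hw hne hn => ?_⟩
  · simpa using h z z hz rfl
  · refine h z w hz hn.symm ?_
    rw [dslope_of_ne _ hne.symm, slope_def_field, hz, hw]
    simp

/-! ### Zeros of polynomials and entire functions under a theta-sum bound -/

theorem polynomial_zeros_of_thetaSum_lt {P : Polynomial ℂ} {N : ℕ} {s : ℝ} (hN : 1 ≤ N)
    (hdeg : P.natDegree = N) (hs : 0 < s) (ha : ∀ k ≤ N, P.coeff k ≠ 0)
    (hq : ∀ k, k + 2 ≤ N →
      ‖P.coeff k‖ * ‖P.coeff (k + 2)‖ ≤ s ^ 2 * ‖P.coeff (k + 1)‖ ^ 2)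
    (hS : ∀ j ≤ N, thetaSum s j + thetaSum s (N - j) < 1) :
    (∀ z : ℂ, P.IsRoot z → P.rootMultiplicity z = 1) ∧
      (∀ z w : ℂ, P.IsRoot z → P.IsRoot w → z ≠ w → ‖z‖ ≠ ‖w‖) := by
  have hdom : ∀ j ≤ N, ∀ z : ℂ, z ≠ 0 →
      (j + 1 ≤ N → ‖P.coeff (j + 1)‖ * ‖z‖ ≤ s * ‖P.coeff j‖) →
      (∀ i, i + 1 = j → ‖P.coeff i‖ ≤ s * ‖P.coeff j‖ * ‖z‖) →
      ‖P.eval z - P.coeff j * z ^ j‖ < ‖P.coeff j * z ^ j‖ := by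
    intro j hj z hz hR hL
    rw [P.eval_eq_sum_range, hdeg]
    refine (norm_sum_sub_le hs hj ha hq hz hR hL).trans_lt ?_
    exact mul_lt_of_lt_one_left
      (norm_pos_iff.2 (mul_ne_zero (ha j hj) (pow_ne_zero _ hz))) (hS j hj)
  have hP : P ≠ 0 := fun h => ha 0 (by omega) (by simp [h])
  have hP0 : P.eval 0 ≠ 0 := by
    rw [← P.coeff_zero_eq_eval_zero]; exact ha 0 (by omega)
  set ρ := dominantRadius P.coeff s with hρ
  have hρpos : ∀ i ≤ N, 0 < ρ i := fun i hi => dominantRadius_pos hs hN ha hi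
  have hL : ∀ (j) (z : ℂ), j ≤ N → ρ j ≤ ‖z‖ →
      ∀ i, i + 1 = j → ‖P.coeff i‖ ≤ s * ‖P.coeff j‖ * ‖z‖ := by
    rintro j z hj hz i rfl
    exact le_of_dominantRadius_le hs (ha _ hj) hz
  obtain ⟨h1, h2⟩ := simple_and_norm_ne_of_dslope_ne_zero (f := fun z => P.eval z) (by
    intro z w hz hzw
    refine dslope_ne_zero_of_dominant P.differentiable hP0 (a := P.coeff) hρpos ?_ ?_ hz ?_ hzw
    · exact fun z hz hz0 => hdom 0 (by omega) z hz
        (fun h => mul_le_of_le_dominantRadius hs ha hq h hz0) (fun i hi => by omega)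
    · intro j hj z hz
      exact hdom j hj z (norm_pos_iff.1 (hz ▸ hρpos j hj))
        (fun h => mul_le_of_le_dominantRadius hs ha hq h hz.le) (hL j z hj hz.ge)
    -- The leading term has no right neighbour, so it dominates everywhere on and outside its
    -- circle, and no zero lies there.
    · by_contra hge
      have := hdom N le_rfl z (fun h => hP0 (h ▸ hz)) (fun h => by omega)
        (hL N z le_rfl (not_lt.1 hge))
      simp [show P.eval z = 0 from hz] at this)
  refine ⟨fun z hz => ?_, h2⟩
  have hpos := (Polynomial.rootMultiplicity_pos hP).2 hz
  by_contra hne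
  have hgt : 1 < P.rootMultiplicity z := by omega
  rw [Polynomial.one_lt_rootMultiplicity_iff_isRoot hP] at hgt
  exact h1 z hz (by simpa using hgt.2)

theorem entire_zeros_of_thetaSum_lt {f : ℂ → ℂ} {a : ℕ → ℂ} {s T : ℝ} (hf : Differentiable ℂ f)
    (hsum : ∀ z : ℂ, HasSum (fun k => a k * z ^ k) (f z)) (hs : 0 < s) (hs1 : s ≤ 1)
    (ha : ∀ k, a k ≠ 0)
    (hq : ∀ k, ‖a k‖ * ‖a (k + 2)‖ ≤ s ^ 2 * ‖a (k + 1)‖ ^ 2)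
    (hT : ∀ n, thetaSum s n ≤ T) (hS : ∀ j, thetaSum s j + T < 1) :
    (∀ z : ℂ, f z = 0 → analyticOrderAt f z = 1) ∧
      (∀ z w : ℂ, f z = 0 → f w = 0 → z ≠ w → ‖z‖ ≠ ‖w‖) := by
  have hdom : ∀ j, ∀ z : ℂ, z ≠ 0 → ‖a (j + 1)‖ * ‖z‖ ≤ s * ‖a j‖ →
      (∀ i, i + 1 = j → ‖a i‖ ≤ s * ‖a j‖ * ‖z‖) →
      ‖f z - a j * z ^ j‖ < ‖a j * z ^ j‖ := by
    intro j z hz hR hL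
    have hlim := (((hsum z).tendsto_sum_nat.comp (Filter.tendsto_add_atTop_nat 1)).sub_const
      (a j * z ^ j)).norm
    have hle : ‖f z - a j * z ^ j‖ ≤ (thetaSum s j + T) * ‖a j * z ^ j‖ := by
      -- The finite estimate holds for every partial sum with N ≥ j. Since T bounds all the theta
      -- sums, it survives the limit, and strictness comes from `hS` afterwards.
      refine le_of_tendsto hlim (Filter.eventually_atTop.2 ⟨j, fun N hN => ?_⟩)
      refine (norm_sum_sub_le hs hN (fun k _ => ha k) (fun k _ => hq k) hz
        (fun _ => hR) hL).trans ?_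
      gcongr
      exact hT _
    refine hle.trans_lt ?_
    exact mul_lt_of_lt_one_left
      (norm_pos_iff.2 (mul_ne_zero (ha j) (pow_ne_zero _ hz))) (hS j)
  have hf0 : f 0 ≠ 0 := by
    have h := (hsum 0).unique (hasSum_single 0 fun k hk => by simp [hk])
    rw [h]
    simpa using ha 0
  set ρ := dominantRadius a s with hρ
  have hρpos : ∀ i, 0 < ρ i := fun i =>
    dominantRadius_pos hs (Nat.le_add_left 1 i) (fun k _ => ha k) (Nat.le_succ i)
  obtain ⟨h1, h2⟩ := simple_and_norm_ne_of_dslope_ne_zero (f := f) (by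
    intro z w hz hzw
    have hR : ∀ (j) (z : ℂ), ‖z‖ ≤ ρ j → ‖a (j + 1)‖ * ‖z‖ ≤ s * ‖a j‖ := fun j z hz =>
      mul_le_of_le_dominantRadius hs (N := j + 1) (fun k _ => ha k) (fun k _ => hq k) le_rfl hz
    have hex : ∃ j, ‖z‖ < ρ j := by
      -- Outside every circle the term moduli would be nondecreasing, because s ≤ 1, and could not
      -- tend to 0.
      by_contra! hge
      have hgrow : ∀ j, ‖a 0‖ ≤ ‖a j * z ^ j‖ := by
        intro j
        induction j with
        | zero => simp
        | succ j ih =>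
          refine ih.trans ?_
          have h3 := le_of_dominantRadius_le hs (ha (j + 1)) (hge (j + 1))
          simp only [norm_mul, norm_pow]
          calc ‖a j‖ * ‖z‖ ^ j ≤ s * ‖a (j + 1)‖ * ‖z‖ * ‖z‖ ^ j := by gcongr
            _ ≤ 1 * ‖a (j + 1)‖ * ‖z‖ * ‖z‖ ^ j := by gcongr
            _ = _ := by ring
      have hlim := (hsum z).summable.tendsto_atTop_zero.norm
      rw [norm_zero] at hlim
      exact absurd (ge_of_tendsto' hlim hgrow) (not_le.2 (norm_pos_iff.2 (ha 0)))
    obtain ⟨j, hj⟩ := hex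
    refine dslope_ne_zero_of_dominant hf hf0 (a := a) (ρ := ρ) (j := j) (fun i _ => hρpos i)
      ?_ ?_ hz hj hzw
    · exact fun z hz hz0 => hdom 0 z hz (hR 0 z hz0) (fun i hi => by omega)
    · intro j _ z hz
      refine hdom j z (norm_pos_iff.1 (hz ▸ hρpos j)) (hR j z hz.le) ?_
      rintro i rfl
      exact le_of_dominantRadius_le hs (ha _) hz.ge)
  refine ⟨fun z hz => ?_, h2⟩
  have := (hf.analyticAt z).analyticOrderAt_sub_eq_one_of_deriv_ne_zero (h1 z hz)
  simpa [hz] using this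

/-! ### From second quotients to theta sums -/

theorem rpow_neg_half_pow {c : ℝ} (hc : 0 < c) (m : ℕ) :
    (c ^ (-(1 / 2) : ℝ)) ^ ((m + 1) ^ 2) = c ^ (-((m : ℝ) + 1) ^ 2 / 2) := by
  rw [← Real.rpow_natCast, ← Real.rpow_mul hc.le]
  congr 1
  push_cast
  ring

theorem thetaSum_rpow {c : ℝ} (hc : 0 < c) (n : ℕ) :
    thetaSum (c ^ (-(1 / 2) : ℝ)) n =
      ∑ k ∈ Finset.range n, c ^ (-((k : ℝ) + 1) ^ 2 / 2) :=
  Finset.sum_congr rfl fun m _ => rpow_neg_half_pow hc m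

theorem mul_le_of_le_secondQuotient {a : ℕ → ℂ} {c : ℝ} (hc : 0 < c) {k : ℕ} (h0 : a k ≠ 0)
    (h2 : a (k + 2) ≠ 0) (h : c ≤ ‖secondQuotient a (k + 2)‖) :
    ‖a k‖ * ‖a (k + 2)‖ ≤ (c ^ (-(1 / 2) : ℝ)) ^ 2 * ‖a (k + 1)‖ ^ 2 := by
  have hs : (c ^ (-(1 / 2) : ℝ)) ^ 2 = c⁻¹ := by
    rw [← Real.rpow_natCast, ← Real.rpow_mul hc.le, ← Real.rpow_neg_one]
    norm_num
  have hp : 0 < ‖a k‖ * ‖a (k + 2)‖ := mul_pos (norm_pos_iff.2 h0) (norm_pos_iff.2 h2)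
  simp only [secondQuotient, Nat.add_sub_cancel, show k + 2 - 1 = k + 1 by omega, norm_div,
    norm_mul, norm_pow] at h
  rw [le_div_iff₀ hp] at h
  rw [hs, inv_mul_eq_div, le_div_iff₀ hc]
  linarith

theorem thetaSum_bEven (n : ℕ) (hn : 1 ≤ n) :
    2 * thetaSum (bEven n hn ^ (-(1 / 2) : ℝ)) n = 1 := by
  obtain ⟨hb, h⟩ := bEven_spec n hn
  rw [thetaSum_rpow hb, ← sum_Icc_shift]
  linarith

theorem thetaSum_lt_of_bEven_lt {n : ℕ} (hn : 1 ≤ n) {c : ℝ} (hc : bEven n hn < c) :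
    2 * thetaSum (c ^ (-(1 / 2) : ℝ)) n < 1 := by
  have hb := (bEven_spec n hn).1
  refine lt_of_lt_of_eq ?_ (thetaSum_bEven n hn)
  rw [thetaSum_rpow hb, thetaSum_rpow (hb.trans hc)]
  exact mul_lt_mul_of_pos_left (Finset.sum_lt_sum_of_nonempty ⟨0, Finset.mem_range.2 hn⟩
    (fun k _ => term_lt _ _ hb hc k)) two_pos

theorem thetaSum_le_half_bInfty (n : ℕ) : thetaSum (bInfty ^ (-(1 / 2) : ℝ)) n ≤ 1 / 2 := by
  obtain ⟨hb, hsum, h⟩ := bInfty_spec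
  rw [thetaSum_rpow hb]
  have := hsum.sum_le_tsum (Finset.range n) (fun k _ => Real.rpow_nonneg hb.le _)
  linarith

theorem theorem1 :
    -- (i) polynomials of even degree `2n`
    (∀ (n : ℕ) (hn : 1 ≤ n) (P : Polynomial ℂ), P.natDegree = 2 * n →
      (∀ k ≤ 2 * n, P.coeff k ≠ 0) →
      (∀ k, 2 ≤ k → k ≤ 2 * n → bEven n hn < ‖secondQuotient P.coeff k‖) →
      (∀ z : ℂ, P.IsRoot z → P.rootMultiplicity z = 1) ∧
      (∀ z w : ℂ, P.IsRoot z → P.IsRoot w → z ≠ w → ‖z‖ ≠ ‖w‖)) ∧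
    -- (ii) polynomials of odd degree `2n + 1`
    (∀ (n : ℕ) (_ : 1 ≤ n) (P : Polynomial ℂ), P.natDegree = 2 * n + 1 →
      (∀ k ≤ 2 * n + 1, P.coeff k ≠ 0) →
      (∀ k, 2 ≤ k → k ≤ 2 * n + 1 →
        bEven (n + 1) (Nat.le_add_left 1 n) ≤ ‖secondQuotient P.coeff k‖) →
      (∀ z : ℂ, P.IsRoot z → P.rootMultiplicity z = 1) ∧
      (∀ z w : ℂ, P.IsRoot z → P.IsRoot w → z ≠ w → ‖z‖ ≠ ‖w‖)) ∧
    -- (iii) entire functions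
    (∀ (f : ℂ → ℂ) (a : ℕ → ℂ), Differentiable ℂ f →
      (∀ z : ℂ, HasSum (fun k => a k * z ^ k) (f z)) →
      (∀ k, a k ≠ 0) →
      (∀ k, 2 ≤ k → bInfty ≤ ‖secondQuotient a k‖) →
      (∀ z : ℂ, f z = 0 → analyticOrderAt f z = 1) ∧
      (∀ z w : ℂ, f z = 0 → f w = 0 → z ≠ w → ‖z‖ ≠ ‖w‖)) := by
  refine ⟨fun n hn P hdeg ha hq => ?_, fun n hn P hdeg ha hq => ?_, fun f a hf hsum ha hq => ?_⟩
  · have hb := (bEven_spec n hn).1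
    -- The smallest of the finitely many |q_k| still exceeds `bEven n hn`, so a single s gives a
    -- strict bound 2θ_n < 1.
    obtain ⟨k₀, hk₀, hmin⟩ := (Finset.Icc 2 (2 * n)).exists_min_image
      (fun k => ‖secondQuotient P.coeff k‖) ⟨2, Finset.mem_Icc.2 ⟨le_rfl, by omega⟩⟩
    rw [Finset.mem_Icc] at hk₀
    have hc := hq k₀ hk₀.1 hk₀.2
    set c := ‖secondQuotient P.coeff k₀‖
    have hs : 0 < c ^ (-(1 / 2) : ℝ) := Real.rpow_pos_of_pos (hb.trans hc) _
    have hlt := thetaSum_lt_of_bEven_lt hn hc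
    have hs1 := le_thetaSum hs hn
    refine polynomial_zeros_of_thetaSum_lt (by omega) hdeg hs ha (fun k hk => ?_) fun j hj => ?_
    · exact mul_le_of_le_secondQuotient (hb.trans hc) (ha k (by omega)) (ha (k + 2) hk)
        (hmin (k + 2) (Finset.mem_Icc.2 ⟨by omega, hk⟩))
    · exact (thetaSum_add_thetaSum_le hs (by linarith) (by omega)).trans_lt hlt
  · have hb := (bEven_spec (n + 1) (Nat.le_add_left 1 n)).1
    have heq := thetaSum_bEven (n + 1) (Nat.le_add_left 1 n)
    set c := bEven (n + 1) (Nat.le_add_left 1 n)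
    have hs : 0 < c ^ (-(1 / 2) : ℝ) := Real.rpow_pos_of_pos hb _
    have hs1 := le_thetaSum hs (Nat.le_add_left 1 n)
    refine polynomial_zeros_of_thetaSum_lt (by omega) hdeg hs ha (fun k hk => ?_) fun j hj => ?_
    · exact mul_le_of_le_secondQuotient hb (ha k (by omega)) (ha (k + 2) hk)
        (hq (k + 2) (by omega) hk)
    -- Adding one term makes the indices sum to 2(n + 1), where the bound is exactly 1. That added
    -- term supplies the strictness, so equality is allowed in the hypothesis.
    · have h1 := thetaSum_lt_succ hs (2 * n + 1 - j)
      have h2 := thetaSum_add_thetaSum_le hs (by linarith) (n := n + 1) (i := j)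
        (j := 2 * n + 1 - j + 1) (by omega)
      linarith
  · have hb := bInfty_spec.1
    have hs : 0 < bInfty ^ (-(1 / 2) : ℝ) := Real.rpow_pos_of_pos hb _
    have hs1 := (le_thetaSum hs le_rfl).trans (thetaSum_le_half_bInfty 1)
    refine entire_zeros_of_thetaSum_lt hf hsum hs (by linarith) ha (fun k => ?_)
      thetaSum_le_half_bInfty fun j => ?_
    · exact mul_le_of_le_secondQuotient hb (ha k) (ha (k + 2)) (hq (k + 2) (by omega))
    -- A partial sum is strictly below the next one, which is at most 1/2; this again absorbs the
    -- case of equality.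
    · have h1 := thetaSum_lt_succ hs j
      have h2 := thetaSum_le_half_bInfty (j + 1)
      linarith
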